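/- Consider a single-server queue with unlimited buffer under the last-come-first-served discipline with preemptive (resume) service: a newly generated update packet immediately preempts the packet in service, and the server always works on the most recently generated unfinished packet; preempted packets are kept and resumed later. The system is empty before time $0$. Packets $i = 0, 1, 2, \dots$ are generated at times $Z_i = \sum_{k=0}^{i-1} X_k$ and have service times $S_i$, where $(X_i)_{i\ge 0}$ are i.i.d. nonnegative random variables with $0 < \mathbb{E}[X] < \infty$, $(S_i)_{i \ge 0}$ are i.i.d. nonnegative random variables, the two sequences are independent of each other, and at least one of the distribution functions $F_X$, $F_S$ is continuous. Let $\mathcal{P}(t)$ be the set of packets whose service is complete by time $t$. The age of information at time $t \ge 0$ is $$A(t) = \min\Big\{ a_0 + t,\ \min_{i \in \mathcal{P}(t)} (t - Z_i) \Big\},$$ where $a_0 \in [0,\infty)$ is an arbitrary fixed initial age (the second minimum is absent if $\mathcal{P}(t)$ is empty), and the average age is $$A^{\mathrm{ave}}_{\mathrm{G/G/1}} = \limsup_{T \to \infty} \mathbb{E}\left[ \frac{1}{T} \int_0^T A(t)\, dt \right].$$ Then $$A^{\mathrm{ave}}_{\mathrm{G/G/1}} = \frac{1}{2}\,\frac{\mathbb{E}[X^2]}{\mathbb{E}[X]}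 + \frac{\mathbb{E}[\min(X,S)]}{\mathbb{P}(S < X)},$$ where $X$ and $S$ are independent and distributed as the inter-generation and service times. Both sides are taken in $[0,\infty]$ (with $c/0 = \infty$ for $c > 0$). In particular, this covers the case $\mathbb{E}[S] < \mathbb{E}[X]$, in which $\mathbb{P}(S < X) > 0$. -/

import Mathlib

open MeasureTheory ProbabilityTheory Filter
open scoped ENNReal NNReal

noncomputable section

namespace LCFSp

/-- Generation time of packet `i`, when `x k` is the time between the generations of packets `k`
and `k + 1` and packet `0` is generated at time `0`. -/
def genTime (x : ℕ → ℝ) (i : ℕ) : ℝ := ∑ k ∈ Finset.range i, x k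

/-- A stack holds the unfinished packets, the most recently generated one first, each with its
remaining service requirement.  `workOff d q` is what is left of the stack `q` after the single
server has worked for `d` time units without any new packet arriving: it always works on the most
recently generated unfinished packet. -/
def workOff : ℝ → List (ℕ × ℝ) → List (ℕ × ℝ)
  | _, [] => []
  | d, (i, r) :: q => if r ≤ d then workOff (d - r) q else (i, r - d) :: q

/-- The stack just after the generation of packet `k` (the system starts empty).  A new packet `k`,
with service time `s k`, preempts the packet in service; the preempted packet stays in the queue
and its service is resumed later. -/
def stackAtGen (x s : ℕ → ℝ) : ℕ → List (ℕ × ℝ)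
  | 0 => [(0, s 0)]
  | k + 1 => (k + 1, s (k + 1)) :: workOff (x k) (stackAtGen x s k)

/-- The set of packets received by the destination up to time `t`: the packets that are generated
by time `t` and whose service is complete at time `t`.  Here `k` is the last packet generated by
time `t`. -/
def received (x s : ℕ → ℝ) (t : ℝ) : Set ℕ :=
  {i | ∃ k, genTime x k ≤ t ∧ t < genTime x (k + 1) ∧ i ≤ k ∧
    ∀ r, (i, r) ∉ workOff (t - genTime x k) (stackAtGen x s k)}

/-- Age of information at time `t`: the minimum of the ages of the packets received up to time `t`
(`ENNReal.ofReal` is `0` at negative reals, and an infimum over no packet is `∞`).  At time `0` the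
destination holds an update of age `a₀`. -/
def age (a₀ : ℝ≥0) (x s : ℕ → ℝ) (t : ℝ) : ℝ≥0∞ :=
  min (ENNReal.ofReal (a₀ + t)) (⨅ i ∈ received x s t, ENNReal.ofReal (t - genTime x i))

/-- Average age: the limit superior, as `T → ∞`, of the expected value of
`(1 / T) ∫₀ᵀ A(t) dt`. -/
def averageAge {Ω : Type*} [MeasurableSpace Ω] (P : Measure Ω) (a₀ : ℝ≥0) (X S : ℕ → Ω → ℝ) :
    ℝ≥0∞ :=
  limsup (fun T : ℝ => ∫⁻ ω, (∫⁻ t in Set.Icc 0 T, age a₀ (fun n => X n ω) (fun n => S n ω) t) /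
    ENNReal.ofReal T ∂P) atTop

end LCFSp

end

/-!
Let `D k` be the age, at the generation of packet `k`, of the freshest update received from earlier
packets. Under preemptive last-come-first-served service, a packet that is still unfinished at the
next generation can only be completed after a fresher one, so it never lowers the age. Hence the
age on the interval after the generation of packet `k` depends on the past through `D k` only
(`age_eq`), where `D (k + 1) = X k` if `S k ≤ X k` and `D (k + 1) = X k + D k` otherwise, and the
integral of the age over that interval is `X k ^ 2 / 2 + D k * min (X k) (S k)`
(`setLIntegral_age_eq`). As `D k`, and the event that packet `k` is generated by time `T`, are
functions of the earlier packets, they are independent of `X k` and `S k`. Let `m` be the expected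
number of packets generated by time `T` and `U` the expected sum of `D k` over them. Then Wald's
identity gives, up to the last interval,

  `E ∫ age = m * E[X ^ 2] / 2 + U * E[min X S]`,

and summing the recursion gives `U ≈ m * E[X] + P(X < S) * U`, that is `U ≈ m * E[X] / P(S ≤ X)`.
As `m / T` tends to `1 / E[X]`, the average age follows; `S ≤ X` may be replaced by `S < X` since
ties have probability zero.

None of the moments on the right is assumed finite except `E[X]`, so the two inequalities are proved
differently. The upper bound (`limsup_totalAge_le`) counts the last interval in full: the recursion
loses mass only when packets cease to be counted, which is in the right direction
(`mul_lookbackSum_le`), and `m ≤ (T + c) / E[min X c]` because the truncated increments overshoot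
`T` by at most `c`. The lower bound (`le_limsup_totalAge`) truncates `X`, `X ^ 2` and `min X S` at
level `n` and discounts `D` by `θ = n / (n + 1)` at each step. This makes `D` bounded, so that both
the last interval and the error in the recursion (`renewalFun_mul_le_lookbackSum`) cost a constant
independent of `T`; then `m ≥ T / E[X]` gives a bound that tends to the claimed value as `n → ∞`,
also when that value is infinite.
-/

namespace LCFSp

/-! ### Generation times -/

lemma genTime_succ (x : ℕ → ℝ) (k : ℕ) : genTime x (k + 1) = genTime x k + x k :=
  Finset.sum_range_succ _ _

lemma genTime_zero (x : ℕ → ℝ) : genTime x 0 = 0 := Finset.sum_range_zero _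

lemma monotone_genTime {x : ℕ → ℝ} (hx : ∀ k, 0 ≤ x k) : Monotone (genTime x) :=
  monotone_nat_of_le_succ fun k => by rw [genTime_succ]; linarith [hx k]

lemma genTime_nonneg {x : ℕ → ℝ} (hx : ∀ k, 0 ≤ x k) (k : ℕ) : 0 ≤ genTime x k :=
  Finset.sum_nonneg fun i _ => hx i

/-- The indicator, with values in `[0, ∞]`, of packet `k` being generated by time `T`. -/
noncomputable def generatedBy (T : ℝ) (x : ℕ → ℝ) (k : ℕ) : ℝ≥0∞ :=
  if genTime x k ≤ T then 1 else 0

/-- The indicator, with values in `[0, ∞]`, of packet `k` being the last one generated by time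
`T`. -/
noncomputable def lastBy (T : ℝ) (x : ℕ → ℝ) (k : ℕ) : ℝ≥0∞ :=
  if genTime x k ≤ T ∧ T < genTime x (k + 1) then 1 else 0

lemma generatedBy_eq_succ_add_lastBy {x : ℕ → ℝ} (hx : ∀ k, 0 ≤ x k) (T : ℝ) (k : ℕ) :
    generatedBy T x k = generatedBy T x (k + 1) + lastBy T x k := by
  have := monotone_genTime hx (Nat.le_succ k)
  unfold generatedBy lastBy
  by_cases h : genTime x (k + 1) ≤ T
  · simp [h, this.trans h, not_lt.2 h]
  · by_cases h' : genTime x k ≤ T <;> simp [h, h', not_le.1 h]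

lemma generatedBy_succ_le {x : ℕ → ℝ} (hx : ∀ k, 0 ≤ x k) (T : ℝ) (k : ℕ) :
    generatedBy T x (k + 1) ≤ generatedBy T x k := by
  rw [generatedBy_eq_succ_add_lastBy hx T k]; exact le_self_add

lemma tsum_lastBy_le_one {x : ℕ → ℝ} (hx : ∀ k, 0 ≤ x k) (T : ℝ) :
    ∑' k, lastBy T x k ≤ 1 := by
  refine ENNReal.tsum_le_of_sum_range_le fun n => ?_
  -- The sum telescopes.
  have h : ∑ k ∈ Finset.range n, lastBy T x k + generatedBy T x n = generatedBy T x 0 := by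
    induction n with
    | zero => simp
    | succ n ih =>
      rw [Finset.sum_range_succ, ← ih, generatedBy_eq_succ_add_lastBy hx T n]; ring
  calc _ ≤ generatedBy T x 0 := h ▸ le_self_add
    _ ≤ 1 := by unfold generatedBy; split_ifs <;> simp

/-- The overshoot over `T` of the truncated increments is at most the truncation level. -/
lemma tsum_generatedBy_mul_min_le {x : ℕ → ℝ} (hx : ∀ k, 0 ≤ x k) (T : ℝ) (c : ℝ≥0∞) :
    ∑' k, generatedBy T x k * min (ENNReal.ofReal (x k)) c ≤ ENNReal.ofReal T + c := by
  refine ENNReal.tsum_le_of_sum_range_le fun n => ?_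
  suffices h : ∑ k ∈ Finset.range n, generatedBy T x k * min (ENNReal.ofReal (x k)) c ≤
      min (ENNReal.ofReal (genTime x n)) (ENNReal.ofReal T + c) from h.trans (min_le_right _ _)
  induction n with
  | zero => simp
  | succ n ih =>
    rw [Finset.sum_range_succ]
    have hZ : ENNReal.ofReal (genTime x (n + 1)) =
        ENNReal.ofReal (genTime x n) + ENNReal.ofReal (x n) := by
      rw [genTime_succ, ENNReal.ofReal_add (genTime_nonneg hx n) (hx n)]
    by_cases h : genTime x n ≤ T
    · simp only [generatedBy, h, if_true, one_mul]
      refine le_min ?_ ?_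
      · rw [hZ]; exact add_le_add (ih.trans (min_le_left _ _)) (min_le_left _ _)
      · exact add_le_add ((ih.trans (min_le_left _ _)).trans (ENNReal.ofReal_le_ofReal h))
          (min_le_right _ _)
    · simp only [generatedBy, h, if_false, zero_mul, add_zero]
      exact ih.trans (min_le_min_right _ (hZ ▸ le_self_add))

lemma ofReal_le_tsum_generatedBy_mul {x : ℕ → ℝ} (hx : ∀ k, 0 ≤ x k) {T : ℝ}
    (hT : ∃ n, T < genTime x n) :
    ENNReal.ofReal T ≤ ∑' k, generatedBy T x k * ENNReal.ofReal (x k) := by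
  obtain ⟨n, hn⟩ := hT
  refine le_trans ?_ (ENNReal.sum_le_tsum (Finset.range n))
  suffices h : min (ENNReal.ofReal (genTime x n)) (ENNReal.ofReal T) ≤
      ∑ k ∈ Finset.range n, generatedBy T x k * ENNReal.ofReal (x k) by
    rwa [min_eq_right (ENNReal.ofReal_le_ofReal hn.le)] at h
  clear hn
  induction n with
  | zero => simp [genTime_zero]
  | succ n ih =>
    rw [Finset.sum_range_succ]
    by_cases h : genTime x n ≤ T
    · rw [min_eq_left (ENNReal.ofReal_le_ofReal h)] at ih
      simp only [generatedBy, h, if_true, one_mul]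
      rw [genTime_succ, ENNReal.ofReal_add (genTime_nonneg hx n) (hx n)]
      exact (min_le_left _ _).trans (add_le_add_left ih _)
    · rw [min_eq_right (ENNReal.ofReal_le_ofReal (not_le.1 h).le)] at ih
      exact (min_le_right _ _).trans (ih.trans le_self_add)

/-! ### The lookback recursion -/

/-- With `θ = 1` and `g = ENNReal.ofReal`, this is the age, at the generation of packet `k`, of
the freshest earlier packet whose service fitted between its own generation and the next one
(`w₀` plus the generation time of packet `k` if there is no such packet).  A discount `θ < 1` and a
bounded `g` give a bounded minorant of that age. -/
noncomputable def lookback (w₀ θ : ℝ≥0∞) (g : ℝ → ℝ≥0∞) (x s : ℕ → ℝ) : ℕ → ℝ≥0∞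
  | 0 => w₀
  | k + 1 => g (x k) + if s k ≤ x k then 0 else θ * lookback w₀ θ g x s k

/-- The age of the freshest update obtained from packets before packet `k`, at the generation time
of packet `k`. -/
noncomputable abbrev staleAge (a₀ : ℝ≥0) : (ℕ → ℝ) → (ℕ → ℝ) → ℕ → ℝ≥0∞ :=
  lookback a₀ 1 ENNReal.ofReal

lemma lookback_mono {v₀ w₀ η θ : ℝ≥0∞} {f g : ℝ → ℝ≥0∞} (h₀ : v₀ ≤ w₀) (hθ : η ≤ θ)
    (hfg : ∀ y, f y ≤ g y) (x s : ℕ → ℝ) (k : ℕ) :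
    lookback v₀ η f x s k ≤ lookback w₀ θ g x s k := by
  induction k with
  | zero => exact h₀
  | succ k ih =>
    simp only [lookback]
    refine add_le_add (hfg _) ?_
    split_ifs
    · exact le_rfl
    · exact mul_le_mul' hθ ih

/-- A discounted lookback with increments at most `c` stays below the geometric sum `c / (1 - θ)`,
which satisfies `hB` with equality. -/
lemma lookback_le {θ c B : ℝ≥0∞} {g : ℝ → ℝ≥0∞} (hg : ∀ y, g y ≤ c) (hB : c + θ * B ≤ B)
    (x s : ℕ → ℝ) (k : ℕ) : lookback 0 θ g x s k ≤ B := by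
  induction k with
  | zero => exact zero_le
  | succ k ih =>
    simp only [lookback]
    refine le_trans (add_le_add (hg _) ?_) hB
    split_ifs
    · exact zero_le
    · exact mul_le_mul_right ih _

/-! ### The age process along a sample path -/

/-- The part of the stack below packet `k` just after its generation. -/
noncomputable def preempted (x s : ℕ → ℝ) : ℕ → List (ℕ × ℝ)
  | 0 => []
  | k + 1 => workOff (x k) (stackAtGen x s k)

lemma stackAtGen_eq (x s : ℕ → ℝ) (k : ℕ) : stackAtGen x s k = (k, s k) :: preempted x s k := by
  cases k <;> rfl

lemma exists_mem_of_mem_workOff {i : ℕ} {r d : ℝ} {q : List (ℕ × ℝ)} (h : (i, r) ∈ workOff d q) :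
    ∃ r', (i, r') ∈ q := by
  induction q generalizing d with
  | nil => simp [workOff] at h
  | cons p q ih =>
    obtain ⟨j, u⟩ := p
    simp only [workOff] at h
    split_ifs at h
    · obtain ⟨r', hr'⟩ := ih h
      exact ⟨r', List.mem_cons_of_mem _ hr'⟩
    · rcases List.mem_cons.1 h with h | h
      · obtain ⟨rfl, -⟩ := Prod.mk.inj h
        exact ⟨u, List.mem_cons_self⟩
      · exact ⟨r, List.mem_cons_of_mem _ h⟩

lemma lt_of_mem_preempted {x s : ℕ → ℝ} {k i : ℕ} {r : ℝ} (h : (i, r) ∈ preempted x s k) :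
    i < k := by
  induction k generalizing r with
  | zero => simp [preempted] at h
  | succ k ih =>
    obtain ⟨r', h'⟩ := exists_mem_of_mem_workOff h
    rw [stackAtGen_eq] at h'
    rcases List.mem_cons.1 h' with h' | h'
    · exact Nat.lt_succ_of_le (Prod.ext_iff.1 h').1.le
    · exact (ih h').trans (Nat.lt_succ_self k)

/-- While packet `k` is unfinished, nothing below it in the stack is served. -/
lemma workOff_stackAtGen_of_lt {x s : ℕ → ℝ} {k : ℕ} {d : ℝ} (h : d < s k) :
    workOff d (stackAtGen x s k) = (k, s k - d) :: preempted x s k := by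
  rw [stackAtGen_eq, workOff, if_neg (not_le.2 h)]

lemma notMem_workOff_stackAtGen_of_le {x s : ℕ → ℝ} {k : ℕ} {d : ℝ} (h : s k ≤ d) (r : ℝ) :
    (k, r) ∉ workOff d (stackAtGen x s k) := by
  rw [stackAtGen_eq, workOff, if_pos h]
  intro h'
  obtain ⟨r', hr'⟩ := exists_mem_of_mem_workOff h'
  exact lt_irrefl _ (lt_of_mem_preempted hr')

lemma forall_notMem_workOff_stackAtGen_iff {x s : ℕ → ℝ} {k i : ℕ} {d : ℝ} (h : d < s k) :
    (∀ r, (i, r) ∉ workOff d (stackAtGen x s k)) ↔ i ≠ k ∧ ∀ r, (i, r) ∉ preempted x s k := by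
  rw [workOff_stackAtGen_of_lt h]
  simp only [List.mem_cons, Prod.mk.injEq, not_or, not_and]
  constructor
  · intro H
    exact ⟨fun hi => (H (s k - d)).1 hi rfl, fun r => (H r).2⟩
  · rintro ⟨h1, h2⟩ r
    exact ⟨fun hi => absurd hi h1, h2 r⟩

/-- Among the packets completed by the generation of packet `k`, the freshest is the last one whose
service fitted into its own generation interval, so the recursion of `staleAge` gives its age. -/
lemma min_iInf_preempted_eq {x s : ℕ → ℝ} (hx : ∀ k, 0 ≤ x k) (a₀ : ℝ≥0) (k : ℕ) {τ : ℝ}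
    (hτ : 0 ≤ τ) :
    min (ENNReal.ofReal (a₀ + (genTime x k + τ)))
      (⨅ i ∈ {i | i < k ∧ ∀ r, (i, r) ∉ preempted x s k},
        ENNReal.ofReal (genTime x k + τ - genTime x i)) =
      staleAge a₀ x s k + ENNReal.ofReal τ := by
  induction k generalizing τ with
  | zero =>
    simp only [not_lt_zero, false_and, Set.ofPred_false, Set.mem_empty_iff_false, iInf_false,
      iInf_top, le_top, inf_of_le_left, staleAge, lookback, genTime_zero, zero_add]
    rw [ENNReal.ofReal_add a₀.coe_nonneg hτ, ENNReal.ofReal_coe_nnreal]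
  | succ k ih =>
    have hxτ : 0 ≤ x k + τ := add_nonneg (hx k) hτ
    simp only [staleAge, lookback, one_mul]
    by_cases h : s k ≤ x k
    · rw [if_pos h, add_zero, ← ENNReal.ofReal_add (hx k) hτ, genTime_succ]
      apply le_antisymm
      · refine (min_le_right _ _).trans ((iInf₂_le k
          ⟨Nat.lt_succ_self k, notMem_workOff_stackAtGen_of_le h⟩).trans ?_)
        · exact ENNReal.ofReal_le_ofReal (by linarith)
      · refine le_min (ENNReal.ofReal_le_ofReal ?_) (le_iInf₂ fun i hi => ?_)
        · linarith [a₀.2, genTime_nonneg hx k]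
        · have := monotone_genTime hx (Nat.le_of_lt_succ hi.1)
          exact ENNReal.ofReal_le_ofReal (by linarith)
    · have hset : {i | i < k + 1 ∧ ∀ r, (i, r) ∉ preempted x s (k + 1)} =
          {i | i < k ∧ ∀ r, (i, r) ∉ preempted x s k} := by
        ext i
        simp only [preempted, Set.mem_ofPred_eq,
          forall_notMem_workOff_stackAtGen_iff (not_le.1 h), ← and_assoc]
        refine and_congr_left fun _ => ?_
        omega
      have := ih hxτ
      rw [if_neg h, hset, genTime_succ]
      simp only [add_assoc] at this ⊢
      rw [this, ENNReal.ofReal_add (hx k) hτ]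
      ring

/-- Between two generations, the age is the age of the packet in service if that one is finished,
and the age of the freshest earlier update otherwise. -/
lemma age_eq {x s : ℕ → ℝ} (hx : ∀ k, 0 ≤ x k) (a₀ : ℝ≥0) (k : ℕ) {t : ℝ}
    (ht : t ∈ Set.Ico (genTime x k) (genTime x (k + 1))) :
    age a₀ x s t = ENNReal.ofReal (t - genTime x k) +
      if s k ≤ t - genTime x k then 0 else staleAge a₀ x s k := by
  have hmono := monotone_genTime hx
  have hrec : received x s t =
      {i | i ≤ k ∧ ∀ r, (i, r) ∉ workOff (t - genTime x k) (stackAtGen x s k)} := by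
    ext i
    constructor
    · rintro ⟨l, h1, h2, h3⟩
      -- Intervals between generations may be empty, but only one of them contains `t`.
      obtain rfl : l = k := by
        refine le_antisymm (not_lt.1 fun h => ?_) (not_lt.1 fun h => ?_)
        · exact absurd ht.2 (not_lt.2 ((hmono h).trans h1))
        · exact absurd h2 (not_lt.2 ((hmono h).trans ht.1))
      exact h3
    · exact fun h => ⟨k, ht.1, ht.2, h⟩
  have hτ : 0 ≤ t - genTime x k := sub_nonneg.2 ht.1
  rw [age, hrec]
  by_cases h : s k ≤ t - genTime x k
  · rw [if_pos h, add_zero]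
    apply le_antisymm
    · exact (min_le_right _ _).trans
        (iInf₂_le k ⟨le_rfl, notMem_workOff_stackAtGen_of_le h⟩)
    · refine le_min (ENNReal.ofReal_le_ofReal ?_) (le_iInf₂ fun i hi => ?_)
      · linarith [a₀.2, genTime_nonneg hx k]
      · have := hmono hi.1
        exact ENNReal.ofReal_le_ofReal (by linarith)
  · rw [if_neg h, add_comm (ENNReal.ofReal _), ← min_iInf_preempted_eq hx a₀ k hτ, add_sub_cancel]
    have hset : {i | i ≤ k ∧ ∀ r, (i, r) ∉ workOff (t - genTime x k) (stackAtGen x s k)} =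
        {i | i < k ∧ ∀ r, (i, r) ∉ preempted x s k} := by
      ext i
      simp only [Set.mem_ofPred_eq, forall_notMem_workOff_stackAtGen_iff (not_le.1 h), ← and_assoc]
      refine and_congr_left fun _ => ?_
      omega
    rw [hset]

lemma setLIntegral_ofReal_sub {a b : ℝ} (hab : a ≤ b) :
    ∫⁻ t in Set.Ico a b, ENNReal.ofReal (t - a) = ENNReal.ofReal ((b - a) ^ 2) / 2 := by
  have h : ∫ t in Set.Ico a b, (t - a) = (b - a) ^ 2 / 2 := by
    rw [integral_Ico_eq_integral_Ioc, ← intervalIntegral.integral_of_le hab,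
      intervalIntegral.integral_comp_sub_right (fun t => t), integral_id]
    ring
  rw [← ofReal_integral_eq_lintegral_ofReal, h, ENNReal.ofReal_div_of_pos two_pos]
  · simp
  · exact ((continuous_id.sub continuous_const).integrableOn_Icc (a := a) (b := b)).mono_set
      Set.Ico_subset_Icc_self
  · exact (ae_restrict_mem measurableSet_Ico).mono fun t ht => sub_nonneg.2 ht.1

lemma setLIntegral_age_eq {x s : ℕ → ℝ} (hx : ∀ k, 0 ≤ x k) (a₀ : ℝ≥0) (k : ℕ) :
    ∫⁻ t in Set.Ico (genTime x k) (genTime x (k + 1)), age a₀ x s t =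
      ENNReal.ofReal (x k ^ 2) / 2 + staleAge a₀ x s k * ENNReal.ofReal (min (x k) (s k)) := by
  set a := genTime x k with ha
  have hb : genTime x (k + 1) = a + x k := genTime_succ x k
  rw [setLIntegral_congr_fun measurableSet_Ico fun t ht => age_eq hx a₀ k ht,
    lintegral_add_left (by fun_prop), setLIntegral_ofReal_sub (by rw [hb]; linarith [hx k]), hb,
    add_sub_cancel_left, ← ha]
  congr 1
  have : ∀ t, (if s k ≤ t - a then 0 else staleAge a₀ x s k) =
      (Set.Iio (a + s k)).indicator (fun _ => staleAge a₀ x s k) t := by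
    intro t
    by_cases h : s k ≤ t - a
    · rw [if_pos h, Set.indicator_of_notMem]
      simp only [Set.mem_Iio, not_lt]; linarith
    · rw [if_neg h, Set.indicator_of_mem]
      simp only [Set.mem_Iio]; linarith
  simp only [this]
  rw [lintegral_indicator_const measurableSet_Iio, Measure.restrict_apply measurableSet_Iio,
    Set.inter_comm, Set.Ico_inter_Iio, Real.volume_Ico, min_add_add_left, add_sub_cancel_left]

/-- Covering `[0, T]` by the intervals that follow the generations up to time `T`. -/
lemma setLIntegral_age_le {x s : ℕ → ℝ} (hx : ∀ k, 0 ≤ x k) (a₀ : ℝ≥0) {T : ℝ}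
    (hT : ∃ n, T < genTime x n) :
    ∫⁻ t in Set.Icc 0 T, age a₀ x s t ≤
      ∑' k, generatedBy T x k * (ENNReal.ofReal (x k ^ 2) / 2 +
        staleAge a₀ x s k * ENNReal.ofReal (min (x k) (s k))) := by
  have hcover : Set.Icc 0 T ⊆
      ⋃ k, {t | t ∈ Set.Ico (genTime x k) (genTime x (k + 1)) ∧ genTime x k ≤ T} := by
    intro t ht
    have hex : ∃ n, t < genTime x n := hT.imp fun n hn => ht.2.trans_lt hn
    classical
    have hpos : Nat.find hex ≠ 0 := fun h => by
      have := Nat.find_spec hex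
      rw [h, genTime_zero] at this
      exact absurd ht.1 (not_le.2 this)
    obtain ⟨k, hk⟩ := Nat.exists_eq_succ_of_ne_zero hpos
    have hkt : genTime x k ≤ t := not_lt.1 (Nat.find_min hex (by omega))
    have hkt' := Nat.find_spec hex
    rw [hk] at hkt'
    exact Set.mem_iUnion.2 ⟨k, ⟨hkt, hkt'⟩, hkt.trans ht.2⟩
  refine (lintegral_mono_set hcover).trans ((lintegral_iUnion_le _ _).trans
    (ENNReal.tsum_le_tsum fun k => ?_))
  unfold generatedBy
  by_cases h : genTime x k ≤ T
  · simp only [h, and_true, Set.ofPred_mem_eq, if_true, one_mul]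
    exact (setLIntegral_age_eq hx a₀ k).le
  · simp [h]

/-- Of the intervals that start by time `T`, only the last one is not contained in `[0, T]`, so a sum
of rewards bounded by `C` exceeds the integral of the age by at most `C`. -/
lemma tsum_generatedBy_mul_le {x s : ℕ → ℝ} (hx : ∀ k, 0 ≤ x k) (a₀ : ℝ≥0) (T : ℝ)
    {ρ : ℕ → ℝ≥0∞} {C : ℝ≥0∞} (hρC : ∀ k, ρ k ≤ C)
    (hρ : ∀ k, ρ k ≤ ENNReal.ofReal (x k ^ 2) / 2 +
      staleAge a₀ x s k * ENNReal.ofReal (min (x k) (s k))) :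
    ∑' k, generatedBy T x k * ρ k ≤ (∫⁻ t in Set.Icc 0 T, age a₀ x s t) + C := by
  have hmono := monotone_genTime hx
  have h1 : ∑' k, generatedBy T x (k + 1) * ρ k ≤ ∫⁻ t in Set.Icc 0 T, age a₀ x s t := by
    set A : ℕ → Set ℝ :=
      fun k => {t | t ∈ Set.Ico (genTime x k) (genTime x (k + 1)) ∧ genTime x (k + 1) ≤ T}
    have hA : ∀ k, MeasurableSet (A k) := fun k =>
      measurableSet_Ico.inter (MeasurableSet.const _)
    have hd : Pairwise (Function.onFun Disjoint A) := fun i j hij =>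
      (hmono.pairwise_disjoint_on_Ico_succ hij).mono (fun _ h => h.1) (fun _ h => h.1)
    have hsub : (⋃ k, A k) ⊆ Set.Icc 0 T := Set.iUnion_subset fun k t ht =>
      ⟨(genTime_nonneg hx k).trans ht.1.1, ht.1.2.le.trans ht.2⟩
    refine le_trans ?_ (lintegral_mono_set hsub)
    rw [lintegral_iUnion hA hd]
    refine ENNReal.tsum_le_tsum fun k => ?_
    unfold generatedBy
    by_cases h : genTime x (k + 1) ≤ T
    · simp only [A, h, and_true, Set.ofPred_mem_eq, if_true, one_mul]
      exact (hρ k).trans (setLIntegral_age_eq hx a₀ k).ge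
    · simp [h]
  calc ∑' k, generatedBy T x k * ρ k
      = ∑' k, generatedBy T x (k + 1) * ρ k + ∑' k, lastBy T x k * ρ k := by
        rw [← ENNReal.tsum_add]
        exact tsum_congr fun k => by rw [generatedBy_eq_succ_add_lastBy hx T k, add_mul]
    _ ≤ (∫⁻ t in Set.Icc 0 T, age a₀ x s t) + ∑' k, lastBy T x k * C :=
        add_le_add h1 (ENNReal.tsum_le_tsum fun k => mul_le_mul_right (hρC k) _)
    _ ≤ (∫⁻ t in Set.Icc 0 T, age a₀ x s t) + C := by
        rw [ENNReal.tsum_mul_right]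
        gcongr
        exact mul_le_of_le_one_left zero_le (tsum_lastBy_le_one hx T)

/-! ### Independence of a packet from its past -/

section

variable {Ω : Type*} {X S : ℕ → Ω → ℝ}

/-- The σ-algebra generated by the pairs `(X j, S j)` with `j` in a set of indices. -/
abbrev inputOf (X S : ℕ → Ω → ℝ) (J : Set ℕ) : MeasurableSpace Ω :=
  ⨆ i ∈ Sum.elim id id ⁻¹' J, MeasurableSpace.comap (Sum.elim X S i) inferInstance

lemma measurable_inputOf_left {J : Set ℕ} {j : ℕ} (hj : j ∈ J) :
    Measurable[inputOf X S J] (X j) :=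
  (comap_measurable (X j)).mono
    (le_iSup₂_of_le (f := fun i (_ : i ∈ Sum.elim id id ⁻¹' J) =>
      MeasurableSpace.comap (Sum.elim X S i) inferInstance) (Sum.inl j) hj le_rfl) le_rfl

lemma measurable_inputOf_right {J : Set ℕ} {j : ℕ} (hj : j ∈ J) :
    Measurable[inputOf X S J] (S j) :=
  (comap_measurable (S j)).mono
    (le_iSup₂_of_le (f := fun i (_ : i ∈ Sum.elim id id ⁻¹' J) =>
      MeasurableSpace.comap (Sum.elim X S i) inferInstance) (Sum.inr j) hj le_rfl) le_rfl

lemma inputOf_mono {J K : Set ℕ} (h : J ⊆ K) : inputOf X S J ≤ inputOf X S K :=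
  biSup_mono fun _ hi => h hi

lemma measurable_genTime (k : ℕ) :
    Measurable[inputOf X S (Set.Iio k)] fun ω => genTime (fun n => X n ω) k :=
  Finset.measurable_fun_sum _ fun _ hj => measurable_inputOf_left (Finset.mem_range.1 hj)

lemma measurable_generatedBy (T : ℝ) (k : ℕ) :
    Measurable[inputOf X S (Set.Iio k)] fun ω => generatedBy T (fun n => X n ω) k := by
  unfold generatedBy
  exact Measurable.ite (measurableSet_le (measurable_genTime k) measurable_const)
    measurable_const measurable_const

lemma measurable_lookback (w₀ θ : ℝ≥0∞) {g : ℝ → ℝ≥0∞} (hg : Measurable g) (k : ℕ) :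
    Measurable[inputOf X S (Set.Iio k)]
      fun ω => lookback w₀ θ g (fun n => X n ω) (fun n => S n ω) k := by
  induction k with
  | zero => exact measurable_const
  | succ k ih =>
    have hk : k ∈ Set.Iio (k + 1) := Nat.lt_succ_self k
    have hX : Measurable[inputOf X S (Set.Iio (k + 1))] (X k) := measurable_inputOf_left hk
    have hS : Measurable[inputOf X S (Set.Iio (k + 1))] (S k) := measurable_inputOf_right hk
    have ih' := ih.mono (inputOf_mono (X := X) (S := S)
      (Set.Iio_subset_Iio (Nat.le_succ k))) le_rfl
    simp only [lookback]
    exact (hg.comp hX).add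
      (Measurable.ite (measurableSet_le hS hX) measurable_const (ih'.const_mul θ))

variable [mΩ : MeasurableSpace Ω] {P : Measure Ω}

/-- The input of the queue: two sequences of measurable random variables, each identically
distributed, all of them independent. -/
structure IsInput (P : Measure Ω) (X S : ℕ → Ω → ℝ) : Prop where
  measurable_left : ∀ n, Measurable (X n)
  measurable_right : ∀ n, Measurable (S n)
  identDistrib_left : ∀ n, IdentDistrib (X n) (X 0) P P
  identDistrib_right : ∀ n, IdentDistrib (S n) (S 0) P P
  iIndepFun : iIndepFun (Sum.elim X S) P

namespace IsInput

lemma measurable_elim (h : IsInput P X S) (i : ℕ ⊕ ℕ) : Measurable (Sum.elim X S i) := by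
  cases i
  · exact h.measurable_left _
  · exact h.measurable_right _

lemma inputOf_le (h : IsInput P X S) (J : Set ℕ) : inputOf X S J ≤ mΩ :=
  iSup₂_le fun i _ => (h.measurable_elim i).comap_le

lemma indep_inputOf (h : IsInput P X S) {J K : Set ℕ} (hJK : Disjoint J K) :
    Indep (inputOf X S J) (inputOf X S K) P :=
  indep_iSup_of_disjoint (fun i => (h.measurable_elim i).comap_le) h.iIndepFun
    (hJK.preimage _)

lemma indepFun (h : IsInput P X S) (i j : ℕ) : IndepFun (X i) (S j) P :=
  h.iIndepFun.indepFun (i := Sum.inl i) (j := Sum.inr j) Sum.inl_ne_inr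

lemma lintegral_comp_eq [IsProbabilityMeasure P] (h : IsInput P X S) {φ : ℝ × ℝ → ℝ≥0∞}
    (hφ : Measurable φ) (k : ℕ) :
    ∫⁻ ω, φ (X k ω, S k ω) ∂P = ∫⁻ ω, φ (X 0 ω, S 0 ω) ∂P :=
  (((h.identDistrib_left k).prodMk (h.identDistrib_right k) (h.indepFun k k)
    (h.indepFun 0 0)).comp hφ).lintegral_eq

/-- The decision that packet `k` is generated by time `T`, and the lookback at its generation, do
not depend on `X k` and `S k`. -/
lemma lintegral_mul_comp [IsProbabilityMeasure P] (h : IsInput P X S) {φ : ℝ × ℝ → ℝ≥0∞}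
    (hφ : Measurable φ) {k : ℕ} {V : Ω → ℝ≥0∞} (hV : Measurable[inputOf X S (Set.Iio k)] V) :
    ∫⁻ ω, V ω * φ (X k ω, S k ω) ∂P = (∫⁻ ω, V ω ∂P) * ∫⁻ ω, φ (X 0 ω, S 0 ω) ∂P := by
  have hk : k ∈ ({k} : Set ℕ) := Set.mem_singleton k
  rw [← h.lintegral_comp_eq hφ k]
  exact lintegral_mul_eq_lintegral_mul_lintegral_of_independent_measurableSpace (h.inputOf_le _)
    (h.inputOf_le {k}) (h.indep_inputOf (by simp)) hV
    (hφ.comp ((measurable_inputOf_left hk).prodMk (measurable_inputOf_right hk)))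

end IsInput

/-! ### Expected sums up to a time horizon -/

/-- The expected number of packets generated by time `T`. -/
noncomputable def renewalFun (P : Measure Ω) (X : ℕ → Ω → ℝ) (T : ℝ) : ℝ≥0∞ :=
  ∑' k, ∫⁻ ω, generatedBy T (fun n => X n ω) k ∂P

/-- The expected sum of the lookbacks at the generations by time `T`. -/
noncomputable def lookbackSum (P : Measure Ω) (X S : ℕ → Ω → ℝ) (w₀ θ : ℝ≥0∞)
    (g : ℝ → ℝ≥0∞) (T : ℝ) : ℝ≥0∞ :=
  ∑' k, ∫⁻ ω, generatedBy T (fun n => X n ω) k *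
    lookback w₀ θ g (fun n => X n ω) (fun n => S n ω) k ∂P

namespace IsInput

variable [IsProbabilityMeasure P]

/-- Wald's identity. -/
lemma lintegral_tsum_generatedBy_mul (h : IsInput P X S) {φ : ℝ → ℝ≥0∞} (hφ : Measurable φ)
    (T : ℝ) :
    ∫⁻ ω, ∑' k, generatedBy T (fun n => X n ω) k * φ (X k ω) ∂P =
      renewalFun P X T * ∫⁻ ω, φ (X 0 ω) ∂P := by
  have hm : ∀ k, Measurable fun ω => generatedBy T (fun n => X n ω) k * φ (X k ω) := fun k =>
    ((measurable_generatedBy (S := S) T k).mono (h.inputOf_le _) le_rfl).mul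
      (hφ.comp (h.measurable_left k))
  rw [lintegral_tsum fun k => (hm k).aemeasurable, renewalFun, ← ENNReal.tsum_mul_right]
  exact tsum_congr fun k =>
    h.lintegral_mul_comp (φ := fun y => φ y.1) (hφ.comp measurable_fst) (measurable_generatedBy T k)

/-- The reward version of Wald's identity, for the rewards that occur in the integral of the
age. -/
lemma lintegral_tsum_generatedBy_mul_reward (h : IsInput P X S) (w₀ θ : ℝ≥0∞) {g φ : ℝ → ℝ≥0∞}
    (hg : Measurable g) (hφ : Measurable φ) {ψ : ℝ × ℝ → ℝ≥0∞} (hψ : Measurable ψ) (T : ℝ) :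
    ∫⁻ ω, ∑' k, generatedBy T (fun n => X n ω) k * (φ (X k ω) +
        lookback w₀ θ g (fun n => X n ω) (fun n => S n ω) k * ψ (X k ω, S k ω)) ∂P =
      renewalFun P X T * ∫⁻ ω, φ (X 0 ω) ∂P +
        lookbackSum P X S w₀ θ g T * ∫⁻ ω, ψ (X 0 ω, S 0 ω) ∂P := by
  have hI := fun k => measurable_generatedBy (X := X) (S := S) T k
  have hD := fun k => measurable_lookback (X := X) (S := S) w₀ θ hg k
  have hI' := fun k => (hI k).mono (h.inputOf_le _) le_rfl
  have hD' := fun k => (hD k).mono (h.inputOf_le _) le_rfl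
  have hm : ∀ k, Measurable fun ω => generatedBy T (fun n => X n ω) k * φ (X k ω) := fun k =>
    (hI' k).mul (hφ.comp (h.measurable_left k))
  have hm' : ∀ k, Measurable fun ω => generatedBy T (fun n => X n ω) k *
      (lookback w₀ θ g (fun n => X n ω) (fun n => S n ω) k * ψ (X k ω, S k ω)) := fun k =>
    (hI' k).mul ((hD' k).mul (hψ.comp ((h.measurable_left k).prodMk (h.measurable_right k))))
  simp only [mul_add, ENNReal.tsum_add]
  rw [lintegral_add_left (Measurable.tsum hm), h.lintegral_tsum_generatedBy_mul hφ, lookbackSum,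
    ← ENNReal.tsum_mul_right, lintegral_tsum fun k => (hm' k).aemeasurable]
  congr 1
  refine tsum_congr fun k => ?_
  simp only [← mul_assoc]
  exact h.lintegral_mul_comp hψ ((hI k).mul (hD k))

/-- One step of the lookback recursion, in expectation. -/
lemma lintegral_generatedBy_mul_lookback_succ (h : IsInput P X S) (w₀ θ : ℝ≥0∞) {g : ℝ → ℝ≥0∞}
    (hg : Measurable g) (T : ℝ) (k : ℕ) :
    ∫⁻ ω, generatedBy T (fun n => X n ω) k *
        lookback w₀ θ g (fun n => X n ω) (fun n => S n ω) (k + 1) ∂P =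
      (∫⁻ ω, generatedBy T (fun n => X n ω) k ∂P) * ∫⁻ ω, g (X 0 ω) ∂P +
        θ * P {ω | X 0 ω < S 0 ω} * ∫⁻ ω, generatedBy T (fun n => X n ω) k *
          lookback w₀ θ g (fun n => X n ω) (fun n => S n ω) k ∂P := by
  have hI := measurable_generatedBy (X := X) (S := S) T k
  have hD := measurable_lookback (X := X) (S := S) w₀ θ hg k
  have hfail : Measurable fun y : ℝ × ℝ => {y : ℝ × ℝ | y.1 < y.2}.indicator (1 : ℝ × ℝ → ℝ≥0∞) y :=
    measurable_one.indicator (measurableSet_lt measurable_fst measurable_snd)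
  have hP : ∫⁻ ω, {y : ℝ × ℝ | y.1 < y.2}.indicator (1 : ℝ × ℝ → ℝ≥0∞) (X 0 ω, S 0 ω) ∂P =
      P {ω | X 0 ω < S 0 ω} := by
    rw [← lintegral_indicator_one
      (measurableSet_lt (h.measurable_left 0) (h.measurable_right 0))]
    rfl
  have h1 := h.lintegral_mul_comp (φ := fun y => g y.1) (hg.comp measurable_fst) hI
  have h2 := h.lintegral_mul_comp hfail (hI.mul hD)
  simp only [Pi.mul_apply] at h2
  rw [hP] at h2
  rw [mul_assoc, mul_comm (P _), ← h2, ← h1, ← lintegral_const_mul, ← lintegral_add_left]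
  · refine lintegral_congr fun ω => ?_
    simp only [lookback, mul_add]
    congr 1
    by_cases hω : S k ω ≤ X k ω
    · simp [hω]
    · simp only [hω, if_false, Set.indicator, Set.mem_ofPred_eq, not_le.1 hω, if_true, Pi.one_apply]
      ring
  · exact ((hI.mono (h.inputOf_le _) le_rfl).mul (hg.comp (h.measurable_left k)))
  · exact (((hI.mul hD).mono (h.inputOf_le _) le_rfl).mul
      (hfail.comp ((h.measurable_left k).prodMk (h.measurable_right k))))

lemma measure_le_add_measure_lt (h : IsInput P X S) :
    P {ω | S 0 ω ≤ X 0 ω} + P {ω | X 0 ω < S 0 ω} = 1 := by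
  have hc : {ω | X 0 ω < S 0 ω} = {ω | S 0 ω ≤ X 0 ω}ᶜ := Set.ext fun ω => by simp
  rw [hc]
  exact prob_add_prob_compl (measurableSet_le (h.measurable_right 0) (h.measurable_left 0))

/-- Generations cease to count once they pass `T`, so summing the recursion over the packets
generated by time `T` gives an upper bound. -/
lemma mul_lookbackSum_le (h : IsInput P X S) (hX0 : ∀ᵐ ω ∂P, ∀ k, 0 ≤ X k ω) {w₀ : ℝ≥0∞}
    (hw₀ : w₀ ≠ ∞) {g : ℝ → ℝ≥0∞} (hg : Measurable g) (hgint : ∫⁻ ω, g (X 0 ω) ∂P ≠ ∞) (T : ℝ) :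
    P {ω | S 0 ω ≤ X 0 ω} * lookbackSum P X S w₀ 1 g T ≤
      w₀ + renewalFun P X T * ∫⁻ ω, g (X 0 ω) ∂P := by
  set M := ∫⁻ ω, g (X 0 ω) ∂P
  set q := P {ω | X 0 ω < S 0 ω}
  set p := P {ω | S 0 ω ≤ X 0 ω}
  set u : ℕ → ℝ≥0∞ := fun k => ∫⁻ ω, generatedBy T (fun n => X n ω) k *
    lookback w₀ 1 g (fun n => X n ω) (fun n => S n ω) k ∂P with hu
  set i : ℕ → ℝ≥0∞ := fun k => ∫⁻ ω, generatedBy T (fun n => X n ω) k ∂P with hi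
  have hpq : p + q = 1 := h.measure_le_add_measure_lt
  have hq : q ≠ ∞ := measure_ne_top _ _
  have hile : ∀ (x : ℕ → ℝ) k, generatedBy T x k ≤ 1 := fun x k => by
    unfold generatedBy; split_ifs <;> simp
  have hi1 : ∀ k, i k ≤ 1 := fun k =>
    (lintegral_mono fun ω => hile _ k).trans (by simp)
  have hu0 : u 0 ≤ w₀ := by
    refine (lintegral_mono fun ω => mul_le_mul_left (hile _ 0) _).trans ?_
    simp [lookback]
  -- Packet `k + 1` is counted only if packet `k` is.
  have hstep : ∀ k, u (k + 1) ≤ i k * M + q * u k := fun k => by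
    have := h.lintegral_generatedBy_mul_lookback_succ w₀ 1 hg T k
    rw [one_mul] at this
    rw [← this]
    exact lintegral_mono_ae (hX0.mono fun ω hω =>
      mul_le_mul_left (generatedBy_succ_le hω T k) _)
  have hufin : ∀ k, u k ≠ ∞ := fun k => by
    induction k with
    | zero => exact ne_top_of_le_ne_top hw₀ hu0
    | succ k ih =>
      exact ne_top_of_le_ne_top (ENNReal.add_ne_top.2 ⟨ENNReal.mul_ne_top
        (ne_top_of_le_ne_top ENNReal.one_ne_top (hi1 k)) hgint, ENNReal.mul_ne_top hq ih⟩) (hstep k)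
  have hsum : ∀ n, ∑ k ∈ Finset.range (n + 1), u k ≤
      w₀ + (∑ k ∈ Finset.range n, i k) * M + q * ∑ k ∈ Finset.range n, u k := fun n => by
    rw [Finset.sum_range_succ']
    calc _ ≤ ∑ k ∈ Finset.range n, (i k * M + q * u k) + w₀ :=
          add_le_add (Finset.sum_le_sum fun k _ => hstep k) hu0
      _ = _ := by
          rw [Finset.sum_add_distrib, ← Finset.sum_mul, ← Finset.mul_sum]; ring
  have hpart : ∀ n, p * ∑ k ∈ Finset.range n, u k ≤ w₀ + renewalFun P X T * M := fun n => by
    have hfin : q * ∑ k ∈ Finset.range n, u k ≠ ∞ :=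
      ENNReal.mul_ne_top hq (ENNReal.sum_ne_top.2 fun k _ => hufin k)
    -- The partial sums are finite, so `q` times the sum can be added to both sides and cancelled.
    refine (ENNReal.add_le_add_iff_right hfin).1 ?_
    rw [← add_mul, hpq, one_mul]
    refine (Finset.sum_le_sum_of_subset (Finset.range_mono (Nat.le_succ n))).trans
      ((hsum n).trans ?_)
    gcongr
    exact ENNReal.sum_le_tsum _
  rw [lookbackSum, ENNReal.tsum_eq_iSup_nat, ENNReal.mul_iSup]
  exact iSup_le hpart

/-- Only the last packet generated by time `T` is lost when the recursion is summed, so a bounded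
lookback satisfies the reverse inequality up to its bound. -/
lemma renewalFun_mul_le_lookbackSum (h : IsInput P X S) (hX0 : ∀ᵐ ω ∂P, ∀ k, 0 ≤ X k ω)
    {θ B : ℝ≥0∞} {g : ℝ → ℝ≥0∞} (hg : Measurable g)
    (hB : ∀ x s k, lookback 0 θ g x s k ≤ B) (T : ℝ) :
    renewalFun P X T * ∫⁻ ω, g (X 0 ω) ∂P +
        θ * P {ω | X 0 ω < S 0 ω} * lookbackSum P X S 0 θ g T ≤
      lookbackSum P X S 0 θ g T + B := by
  set D : ℕ → Ω → ℝ≥0∞ := fun k ω => lookback 0 θ g (fun n => X n ω) (fun n => S n ω) k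
  have hm : ∀ k l, Measurable fun ω => generatedBy T (fun n => X n ω) k * D l ω := fun k l =>
    ((measurable_generatedBy (S := S) T k).mono (h.inputOf_le _) le_rfl).mul
      ((measurable_lookback 0 θ hg l).mono (h.inputOf_le _) le_rfl)
  have hU : ∑' k, ∫⁻ ω, generatedBy T (fun n => X n ω) (k + 1) * D (k + 1) ω ∂P ≤
      lookbackSum P X S 0 θ g T :=
    ENNReal.tsum_comp_le_tsum_of_injective Nat.succ_injective
      fun k => ∫⁻ ω, generatedBy T (fun n => X n ω) k * D k ω ∂P
  calc _ = ∑' k, ∫⁻ ω, generatedBy T (fun n => X n ω) k * D (k + 1) ω ∂P := by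
        rw [renewalFun, lookbackSum, ← ENNReal.tsum_mul_left, ← ENNReal.tsum_mul_right,
          ← ENNReal.tsum_add]
        exact tsum_congr fun k => (h.lintegral_generatedBy_mul_lookback_succ 0 θ hg T k).symm
    _ = ∫⁻ ω, ∑' k, generatedBy T (fun n => X n ω) k * D (k + 1) ω ∂P :=
        (lintegral_tsum fun k => (hm k (k + 1)).aemeasurable).symm
    _ ≤ ∫⁻ ω, (∑' k, generatedBy T (fun n => X n ω) (k + 1) * D (k + 1) ω + B) ∂P := by
        refine lintegral_mono_ae (hX0.mono fun ω hω => ?_)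
        have hsplit : ∑' k, generatedBy T (fun n => X n ω) k * D (k + 1) ω =
            ∑' k, generatedBy T (fun n => X n ω) (k + 1) * D (k + 1) ω +
              ∑' k, lastBy T (fun n => X n ω) k * D (k + 1) ω := by
          rw [← ENNReal.tsum_add]
          exact tsum_congr fun k => by rw [generatedBy_eq_succ_add_lastBy hω T k, add_mul]
        refine hsplit.trans_le (add_le_add le_rfl ?_)
        calc _ ≤ ∑' k, lastBy T (fun n => X n ω) k * B :=
              ENNReal.tsum_le_tsum fun k => mul_le_mul_right (hB _ _ _) _
          _ ≤ B := by
              rw [ENNReal.tsum_mul_right]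
              exact mul_le_of_le_one_left zero_le (tsum_lastBy_le_one hω T)
    _ ≤ _ := by
        rw [lintegral_add_right _ measurable_const,
          lintegral_tsum fun k => (hm (k + 1) (k + 1)).aemeasurable]
        simpa using add_le_add_left hU B

/-! ### The renewal function -/

lemma renewalFun_mul_lintegral_min_le (h : IsInput P X S) (hX0 : ∀ᵐ ω ∂P, ∀ k, 0 ≤ X k ω) (T : ℝ)
    (c : ℝ≥0∞) :
    renewalFun P X T * ∫⁻ ω, min (ENNReal.ofReal (X 0 ω)) c ∂P ≤ ENNReal.ofReal T + c := by
  rw [← h.lintegral_tsum_generatedBy_mul (φ := fun y => min (ENNReal.ofReal y) c) (by fun_prop)]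
  refine (lintegral_mono_ae (hX0.mono fun ω hω => tsum_generatedBy_mul_min_le hω T c)).trans ?_
  simp

lemma renewalFun_ne_top (h : IsInput P X S) (hX0 : ∀ᵐ ω ∂P, ∀ k, 0 ≤ X k ω)
    (hX : ∫⁻ ω, ENNReal.ofReal (X 0 ω) ∂P ≠ 0) (T : ℝ) : renewalFun P X T ≠ ∞ := by
  intro hm
  have hX0m := h.measurable_left 0
  have hpos : ∫⁻ ω, min (ENNReal.ofReal (X 0 ω)) 1 ∂P ≠ 0 := by
    rw [Ne, lintegral_eq_zero_iff (by fun_prop)] at hX ⊢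
    refine fun h0 => hX (h0.mono fun ω hω => ?_)
    simpa [(zero_le_one' ℝ).not_gt] using hω
  have := h.renewalFun_mul_lintegral_min_le hX0 T 1
  rw [hm, ENNReal.top_mul hpos, top_le_iff] at this
  simp at this

/-- Almost surely the generation times are unbounded, as the expected number of generations by time
`T` is finite. -/
lemma exists_lt_genTime (h : IsInput P X S) (hX0 : ∀ᵐ ω ∂P, ∀ k, 0 ≤ X k ω)
    (hX : ∫⁻ ω, ENNReal.ofReal (X 0 ω) ∂P ≠ 0) (T : ℝ) :
    ∀ᵐ ω ∂P, ∃ n, T < genTime (fun n => X n ω) n := by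
  have hm := fun k => (measurable_generatedBy (X := X) (S := S) T k).mono (h.inputOf_le _) le_rfl
  have hfin := h.renewalFun_ne_top hX0 hX T
  rw [renewalFun, ← lintegral_tsum fun k => (hm k).aemeasurable] at hfin
  filter_upwards [ae_lt_top (Measurable.tsum hm) hfin] with ω hω
  by_contra! hn
  simp [generatedBy, hn] at hω

lemma le_renewalFun_mul (h : IsInput P X S) (hX0 : ∀ᵐ ω ∂P, ∀ k, 0 ≤ X k ω)
    (hX : ∫⁻ ω, ENNReal.ofReal (X 0 ω) ∂P ≠ 0) (T : ℝ) :
    ENNReal.ofReal T ≤ renewalFun P X T * ∫⁻ ω, ENNReal.ofReal (X 0 ω) ∂P := by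
  rw [← h.lintegral_tsum_generatedBy_mul ENNReal.measurable_ofReal]
  calc ENNReal.ofReal T = ∫⁻ _, ENNReal.ofReal T ∂P := by simp
    _ ≤ _ := lintegral_mono_ae <| by
        filter_upwards [hX0, h.exists_lt_genTime hX0 hX T] with ω h1 h2
        exact ofReal_le_tsum_generatedBy_mul h1 h2

end IsInput

end

/-! ### Bounds on the expected integral of the age -/

section

variable {Ω : Type*} [MeasurableSpace Ω] {P : Measure Ω} {X S : ℕ → Ω → ℝ}

/-- The expected integral of the age over `[0, T]`. -/
noncomputable def totalAge (P : Measure Ω) (a₀ : ℝ≥0) (X S : ℕ → Ω → ℝ) (T : ℝ) : ℝ≥0∞ :=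
  ∫⁻ ω, (∫⁻ t in Set.Icc 0 T, age a₀ (fun n => X n ω) (fun n => S n ω) t) ∂P

lemma averageAge_eq_limsup (a₀ : ℝ≥0) :
    averageAge P a₀ X S = limsup (fun T => totalAge P a₀ X S T / ENNReal.ofReal T) atTop := by
  refine limsup_congr ((eventually_gt_atTop 0).mono fun T hT => ?_)
  simp only [div_eq_mul_inv, totalAge]
  exact lintegral_mul_const' _ _ (ENNReal.inv_ne_top.2 (ENNReal.ofReal_pos.2 hT).ne')

lemma tendsto_const_div_ofReal {C : ℝ≥0∞} (hC : C ≠ ∞) :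
    Tendsto (fun T : ℝ => C / ENNReal.ofReal T) atTop (nhds 0) := by
  have := ENNReal.Tendsto.const_div (a := C) ENNReal.tendsto_ofReal_atTop (Or.inr hC)
  rwa [ENNReal.div_top] at this

lemma tendsto_lintegral_min_natCast {f : Ω → ℝ≥0∞} (hf : Measurable f) :
    Tendsto (fun n : ℕ => ∫⁻ ω, min (f ω) n ∂P) atTop (nhds (∫⁻ ω, f ω ∂P)) := by
  refine lintegral_tendsto_of_tendsto_of_monotone (fun n => (hf.min measurable_const).aemeasurable)
    (ae_of_all _ fun ω m n hmn => min_le_min_left _ (Nat.cast_le.2 hmn)) (ae_of_all _ fun ω => ?_)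
  simpa using (tendsto_const_nhds (x := f ω)).min ENNReal.tendsto_nat_nhds_top

/-- If almost surely no service fits into its generation interval, the second summand of the average
age is infinite: its numerator is the positive mean of `X 0`, and its denominator vanishes. -/
lemma lintegral_min_eq_of_measure_le_eq_zero (hp : P {ω | S 0 ω ≤ X 0 ω} = 0) :
    ∫⁻ ω, ENNReal.ofReal (min (X 0 ω) (S 0 ω)) ∂P = ∫⁻ ω, ENNReal.ofReal (X 0 ω) ∂P := by
  have h : ∀ᵐ ω ∂P, ¬ S 0 ω ≤ X 0 ω := by rw [ae_iff]; simpa using hp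
  refine lintegral_congr_ae (h.mono fun ω hω => ?_)
  simp only [min_eq_left (not_le.1 hω).le]

namespace IsInput

variable [IsProbabilityMeasure P]

lemma totalAge_le (h : IsInput P X S) (hX0 : ∀ᵐ ω ∂P, ∀ k, 0 ≤ X k ω)
    (hX : ∫⁻ ω, ENNReal.ofReal (X 0 ω) ∂P ≠ 0) (a₀ : ℝ≥0) (T : ℝ) :
    totalAge P a₀ X S T ≤ renewalFun P X T * ((∫⁻ ω, ENNReal.ofReal (X 0 ω ^ 2) ∂P) / 2) +
      lookbackSum P X S a₀ 1 ENNReal.ofReal T *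
        ∫⁻ ω, ENNReal.ofReal (min (X 0 ω) (S 0 ω)) ∂P := by
  have hX0m := h.measurable_left 0
  have key := h.lintegral_tsum_generatedBy_mul_reward a₀ 1 ENNReal.measurable_ofReal
    (φ := fun y => ENNReal.ofReal (y ^ 2) / 2) (by fun_prop)
    (ψ := fun y => ENNReal.ofReal (min y.1 y.2)) (by fun_prop) T
  simp only [div_eq_mul_inv] at key ⊢
  rw [lintegral_mul_const _ (by fun_prop)] at key
  rw [← key]
  refine lintegral_mono_ae ?_
  filter_upwards [hX0, h.exists_lt_genTime hX0 hX T] with ω h1 h2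
  exact setLIntegral_age_le h1 a₀ h2

/-- Truncation at level `n`, together with the discount `n / (n + 1)`, bounds the lookback by
`n * (n + 1)`. -/
lemma exists_le_totalAge_add (h : IsInput P X S) (hX0 : ∀ᵐ ω ∂P, ∀ k, 0 ≤ X k ω)
    (hX : ∫⁻ ω, ENNReal.ofReal (X 0 ω) ∂P ≠ 0) (a₀ : ℝ≥0) (n : ℕ) :
    ∃ C : ℝ≥0∞, C ≠ ∞ ∧ ∀ T, renewalFun P X T *
      ((∫⁻ ω, min (ENNReal.ofReal (X 0 ω ^ 2)) n ∂P) / 2 +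
        (∫⁻ ω, min (ENNReal.ofReal (X 0 ω)) n ∂P) /
          (1 - (n / (n + 1)) * P {ω | X 0 ω < S 0 ω}) *
        ∫⁻ ω, min (ENNReal.ofReal (min (X 0 ω) (S 0 ω))) n ∂P) ≤ totalAge P a₀ X S T + C := by
  have hX0m := h.measurable_left 0
  set θ : ℝ≥0∞ := n / (n + 1) with hθ
  set B : ℝ≥0∞ := n * (n + 1) with hB
  set g : ℝ → ℝ≥0∞ := fun y => min (ENNReal.ofReal y) n
  set x := ∫⁻ ω, min (ENNReal.ofReal (X 0 ω)) n ∂P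
  set q := P {ω | X 0 ω < S 0 ω}
  set b := ∫⁻ ω, min (ENNReal.ofReal (min (X 0 ω) (S 0 ω))) n ∂P
  set r := 1 - θ * q
  have hn : (n : ℝ≥0∞) ≠ ∞ := ENNReal.natCast_ne_top n
  have hn1 : (n + 1 : ℝ≥0∞) ≠ ∞ := ENNReal.add_ne_top.2 ⟨hn, ENNReal.one_ne_top⟩
  have hBfin : B ≠ ∞ := ENNReal.mul_ne_top hn hn1
  have hq1 : q ≤ 1 := prob_le_one
  have hθ1 : θ < 1 := by
    rw [hθ, ENNReal.div_lt_iff (by simp) (by simp), one_mul]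
    exact ENNReal.lt_add_right hn one_ne_zero
  have hθq : θ * q < 1 := (mul_le_of_le_one_right zero_le hq1).trans_lt hθ1
  have hr0 : r ≠ 0 := (tsub_pos_of_lt hθq).ne'
  have hrfin : r ≠ ∞ := ne_top_of_le_ne_top ENNReal.one_ne_top tsub_le_self
  have hrθ : r + θ * q = 1 := tsub_add_cancel_of_le hθq.le
  have hg : Measurable g := by fun_prop
  have hBeq : n + θ * B = B := by
    rw [hθ, hB, mul_comm (n : ℝ≥0∞) (n + 1), ← mul_assoc, ENNReal.div_mul_cancel (by simp) hn1]
    ring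
  have hD : ∀ x s k, lookback 0 θ g x s k ≤ B :=
    fun x s k => lookback_le (fun y => min_le_right _ _) hBeq.le x s k
  have hDle : ∀ x s k, lookback 0 θ g x s k ≤ staleAge a₀ x s k := fun x s k =>
    lookback_mono zero_le hθ1.le (fun y => min_le_left _ _) x s k
  have hb : b ≤ n := (lintegral_mono fun ω => min_le_right _ _).trans (by simp)
  have hbfin : b ≠ ∞ := ne_top_of_le_ne_top hn hb
  set C : ℝ≥0∞ := n / 2 + B * n
  refine ⟨C + B / r * b, ENNReal.add_ne_top.2 ⟨ENNReal.add_ne_top.2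
    ⟨ENNReal.div_ne_top hn two_ne_zero, ENNReal.mul_ne_top hBfin hn⟩,
    ENNReal.mul_ne_top (ENNReal.div_ne_top hBfin hr0) hbfin⟩, fun T => ?_⟩
  set m := renewalFun P X T
  have hm : m ≠ ∞ := h.renewalFun_ne_top hX0 hX T
  set U := lookbackSum P X S 0 θ g T
  have hU : U ≠ ∞ := by
    refine ne_top_of_le_ne_top (ENNReal.mul_ne_top hm hBfin) ?_
    simp only [U, m, lookbackSum, renewalFun, ← ENNReal.tsum_mul_right]
    refine ENNReal.tsum_le_tsum fun k => ?_
    rw [← lintegral_mul_const' _ _ hBfin]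
    exact lintegral_mono fun ω => mul_le_mul_right (hD _ _ k) _
  have hrec : m * x ≤ r * U + B := by
    have := h.renewalFun_mul_le_lookbackSum hX0 hg hD T
    have hfin : θ * q * U ≠ ∞ := ENNReal.mul_ne_top (hθq.trans ENNReal.one_lt_top).ne hU
    refine (ENNReal.add_le_add_iff_right hfin).1 (this.trans_eq ?_)
    calc U + B = (r + θ * q) * U + B := by rw [hrθ, one_mul]
      _ = r * U + B + θ * q * U := by ring
  have hdiv : m * (x / r) ≤ U + B / r := by
    rw [← mul_div_assoc]
    refine ENNReal.div_le_of_le_mul (hrec.trans_eq ?_)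
    rw [add_mul, ENNReal.div_mul_cancel hr0 hrfin, mul_comm]
  have hreward : m * ((∫⁻ ω, min (ENNReal.ofReal (X 0 ω ^ 2)) n ∂P) / 2) + U * b ≤
      totalAge P a₀ X S T + C := by
    have key := h.lintegral_tsum_generatedBy_mul_reward 0 θ hg
      (φ := fun y => min (ENNReal.ofReal (y ^ 2)) n / 2) (by fun_prop)
      (ψ := fun y => min (ENNReal.ofReal (min y.1 y.2)) n) (by fun_prop) T
    simp only [div_eq_mul_inv _ (2 : ℝ≥0∞)] at key ⊢
    rw [lintegral_mul_const _ (by fun_prop)] at key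
    rw [← key]
    calc _ ≤ ∫⁻ ω, ((∫⁻ t in Set.Icc 0 T, age a₀ (fun n => X n ω) (fun n => S n ω) t) + C) ∂P := by
          refine lintegral_mono_ae (hX0.mono fun ω hω => tsum_generatedBy_mul_le hω a₀ T ?_ ?_)
          · exact fun k => add_le_add (mul_le_mul_left (min_le_right _ _) _)
              (mul_le_mul' (hD _ _ k) (min_le_right _ _))
          · exact fun k => add_le_add (mul_le_mul_left (min_le_left _ _) _)
              (mul_le_mul' (hDle _ _ k) (min_le_left _ _))
      _ = _ := by
          rw [lintegral_add_right _ measurable_const]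
          simp [totalAge]
  calc _ = m * ((∫⁻ ω, min (ENNReal.ofReal (X 0 ω ^ 2)) n ∂P) / 2) + m * (x / r) * b := by ring
    _ ≤ m * ((∫⁻ ω, min (ENNReal.ofReal (X 0 ω ^ 2)) n ∂P) / 2) + (U + B / r) * b := by gcongr
    _ = m * ((∫⁻ ω, min (ENNReal.ofReal (X 0 ω ^ 2)) n ∂P) / 2) + U * b + B / r * b := by ring
    _ ≤ totalAge P a₀ X S T + C + B / r * b := by gcongr
    _ = _ := by ring

/-! ### The limit -/

/-- The term `a₀` contributes a constant to the integral of the age, and `m ≤ (T + n) / E[min X n]`;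
the limit `n → ∞` is taken after the limit in `T`. -/
lemma limsup_totalAge_le (h : IsInput P X S) (hX0 : ∀ᵐ ω ∂P, ∀ k, 0 ≤ X k ω)
    (hX : ∫⁻ ω, ENNReal.ofReal (X 0 ω) ∂P ≠ 0) (hXfin : ∫⁻ ω, ENNReal.ofReal (X 0 ω) ∂P ≠ ∞)
    (a₀ : ℝ≥0) :
    limsup (fun T => totalAge P a₀ X S T / ENNReal.ofReal T) atTop ≤
      ((∫⁻ ω, ENNReal.ofReal (X 0 ω ^ 2) ∂P) / 2 +
        (∫⁻ ω, ENNReal.ofReal (X 0 ω) ∂P) / P {ω | S 0 ω ≤ X 0 ω} *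
          ∫⁻ ω, ENNReal.ofReal (min (X 0 ω) (S 0 ω)) ∂P) / ∫⁻ ω, ENNReal.ofReal (X 0 ω) ∂P := by
  have hX0m := h.measurable_left 0
  have hS0m := h.measurable_right 0
  set M := ∫⁻ ω, ENNReal.ofReal (X 0 ω) ∂P with hM
  set b := ∫⁻ ω, ENNReal.ofReal (min (X 0 ω) (S 0 ω)) ∂P with hb
  set p := P {ω | S 0 ω ≤ X 0 ω}
  set K := (∫⁻ ω, ENNReal.ofReal (X 0 ω ^ 2) ∂P) / 2 + M / p * b with hK
  rcases eq_or_ne K ∞ with hKtop | hKfin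
  · rw [hKtop, ENNReal.top_div_of_ne_top hXfin]; exact le_top
  have hbfin : b ≠ ∞ := ne_top_of_le_ne_top hXfin
    (lintegral_mono fun ω => ENNReal.ofReal_le_ofReal (min_le_left _ _))
  have hp0 : p ≠ 0 := by
    intro hp0
    refine hKfin ?_
    rw [hK, hp0, ENNReal.div_zero hX, hb, lintegral_min_eq_of_measure_le_eq_zero hp0,
      ENNReal.top_mul hX, add_top]
  set C : ℝ≥0∞ := a₀ / p * b
  have hC : C ≠ ∞ := ENNReal.mul_ne_top (ENNReal.div_ne_top ENNReal.coe_ne_top hp0) hbfin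
  have hbound : ∀ T, totalAge P a₀ X S T ≤ renewalFun P X T * K + C := fun T => by
    have hU := h.mul_lookbackSum_le hX0 (w₀ := a₀) ENNReal.coe_ne_top ENNReal.measurable_ofReal
      hXfin T
    have hU' : lookbackSum P X S a₀ 1 ENNReal.ofReal T ≤ (a₀ + renewalFun P X T * M) / p := by
      rw [ENNReal.le_div_iff_mul_le (Or.inl hp0) (Or.inl (measure_ne_top _ _)), mul_comm]
      exact hU
    refine (h.totalAge_le hX0 hX a₀ T).trans
      ((add_le_add le_rfl (mul_le_mul_left hU' _)).trans_eq ?_)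
    simp only [hK, C, div_eq_mul_inv, M]
    ring
  have hlim : Tendsto (fun n : ℕ => K / ∫⁻ ω, min (ENNReal.ofReal (X 0 ω)) n ∂P) atTop
      (nhds (K / M)) :=
    ENNReal.Tendsto.const_div (tendsto_lintegral_min_natCast (by fun_prop)) (Or.inr hKfin)
  refine ge_of_tendsto hlim ((eventually_ge_atTop 1).mono fun n hn => ?_)
  set x := ∫⁻ ω, min (ENNReal.ofReal (X 0 ω)) n ∂P
  have hx0 : x ≠ 0 := by
    rw [hM, Ne, lintegral_eq_zero_iff (by fun_prop)] at hX
    simp only [x]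
    rw [Ne, lintegral_eq_zero_iff (by fun_prop)]
    refine fun h0 => hX (h0.mono fun ω hω => ?_)
    have hn0 : (n : ℝ≥0∞) ≠ 0 := by simp; omega
    rcases min_choice (ENNReal.ofReal (X 0 ω)) (n : ℝ≥0∞) with h' | h'
    · exact h'.symm.trans hω
    · exact absurd (h'.symm.trans hω) hn0
  have hxfin : x ≠ ∞ := ne_top_of_le_ne_top hXfin (lintegral_mono fun ω => min_le_left _ _)
  have ht : Tendsto (fun T : ℝ => K / x + n * (K / x) / ENNReal.ofReal T + C / ENNReal.ofReal T)
      atTop (nhds (K / x)) := by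
    have hKx : K / x ≠ ∞ := ENNReal.div_ne_top hKfin hx0
    simpa using ((tendsto_const_nhds (x := K / x)).add (tendsto_const_div_ofReal
      (ENNReal.mul_ne_top (ENNReal.natCast_ne_top n) hKx))).add (tendsto_const_div_ofReal hC)
  rw [← ht.limsup_eq]
  refine limsup_le_limsup ((eventually_gt_atTop 0).mono fun T hT => ?_)
  have hT0 : ENNReal.ofReal T ≠ 0 := (ENNReal.ofReal_pos.2 hT).ne'
  have hm : renewalFun P X T ≤ (ENNReal.ofReal T + n) / x := by
    rw [ENNReal.le_div_iff_mul_le (Or.inl hx0) (Or.inl hxfin)]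
    exact h.renewalFun_mul_lintegral_min_le hX0 T n
  calc totalAge P a₀ X S T / ENNReal.ofReal T
      ≤ ((ENNReal.ofReal T + n) / x * K + C) / ENNReal.ofReal T := by
        gcongr
        exact (hbound T).trans (by gcongr)
    _ = ENNReal.ofReal T * (ENNReal.ofReal T)⁻¹ * (K / x) +
          n * (K / x) / ENNReal.ofReal T + C / ENNReal.ofReal T := by
        simp only [div_eq_mul_inv]; ring
    _ = _ := by rw [ENNReal.mul_inv_cancel hT0 ENNReal.ofReal_ne_top, one_mul]

/-- For each truncation level the constant error disappears after division by `T`; monotone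
convergence then removes the truncation. -/
lemma le_limsup_totalAge (h : IsInput P X S) (hX0 : ∀ᵐ ω ∂P, ∀ k, 0 ≤ X k ω)
    (hX : ∫⁻ ω, ENNReal.ofReal (X 0 ω) ∂P ≠ 0) (hXfin : ∫⁻ ω, ENNReal.ofReal (X 0 ω) ∂P ≠ ∞)
    (a₀ : ℝ≥0) :
    ((∫⁻ ω, ENNReal.ofReal (X 0 ω ^ 2) ∂P) / 2 +
        (∫⁻ ω, ENNReal.ofReal (X 0 ω) ∂P) / P {ω | S 0 ω ≤ X 0 ω} *
          ∫⁻ ω, ENNReal.ofReal (min (X 0 ω) (S 0 ω)) ∂P) / ∫⁻ ω, ENNReal.ofReal (X 0 ω) ∂P ≤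
      limsup (fun T => totalAge P a₀ X S T / ENNReal.ofReal T) atTop := by
  have hX0m := h.measurable_left 0
  have hS0m := h.measurable_right 0
  set M := ∫⁻ ω, ENNReal.ofReal (X 0 ω) ∂P
  have hbfin : ∫⁻ ω, ENNReal.ofReal (min (X 0 ω) (S 0 ω)) ∂P ≠ ∞ := ne_top_of_le_ne_top hXfin
    (lintegral_mono fun ω => ENNReal.ofReal_le_ofReal (min_le_left _ _))
  have hp1 : P {ω | S 0 ω ≤ X 0 ω} ≠ ∞ := measure_ne_top _ _
  -- Multiplication on `[0, ∞]` is discontinuous at `(∞, 0)`, which does not occur here.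
  have hdegenerate : ∫⁻ ω, ENNReal.ofReal (min (X 0 ω) (S 0 ω)) ∂P ≠ 0 ∨
      M / P {ω | S 0 ω ≤ X 0 ω} ≠ ∞ := by
    rcases eq_or_ne (P {ω | S 0 ω ≤ X 0 ω}) 0 with hp | hp
    · exact Or.inl (lintegral_min_eq_of_measure_le_eq_zero hp ▸ hX)
    · exact Or.inr (ENNReal.div_ne_top hXfin hp)
  have hθ : Tendsto (fun n : ℕ => (n / (n + 1) : ℝ≥0∞)) atTop (nhds 1) := by
    have h1 : Tendsto (fun n : ℕ => ENNReal.ofReal ((n : ℝ) / (n + 1))) atTop (nhds 1) := by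
      simpa using ENNReal.tendsto_ofReal (tendsto_natCast_div_add_atTop (1 : ℝ))
    refine h1.congr fun n => ?_
    rw [ENNReal.ofReal_div_of_pos (by positivity), ENNReal.ofReal_natCast,
      ENNReal.ofReal_add (by positivity) zero_le_one, ENNReal.ofReal_natCast, ENNReal.ofReal_one]
  have hr : Tendsto (fun n : ℕ => 1 - (n / (n + 1) : ℝ≥0∞) * P {ω | X 0 ω < S 0 ω}) atTop
      (nhds (P {ω | S 0 ω ≤ X 0 ω})) := by
    have hlim := ENNReal.Tendsto.sub (tendsto_const_nhds (x := (1 : ℝ≥0∞)))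
      (ENNReal.Tendsto.mul_const (b := P {ω | X 0 ω < S 0 ω}) hθ (Or.inl one_ne_zero))
      (Or.inl ENNReal.one_ne_top)
    rwa [one_mul, ← ENNReal.eq_sub_of_add_eq (measure_ne_top _ _) h.measure_le_add_measure_lt]
      at hlim
  have hlim := ENNReal.Tendsto.div_const (b := M)
    ((ENNReal.Tendsto.div_const (tendsto_lintegral_min_natCast (P := P)
        (f := fun ω => ENNReal.ofReal (X 0 ω ^ 2)) (by fun_prop)) (Or.inr two_ne_zero)).add
      (ENNReal.Tendsto.mul
        (ENNReal.Tendsto.div (tendsto_lintegral_min_natCast (P := P)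
          (f := fun ω => ENNReal.ofReal (X 0 ω)) (by fun_prop)) (Or.inl hX) hr (Or.inl hp1))
        (Or.inr hbfin)
        (tendsto_lintegral_min_natCast (P := P)
          (f := fun ω => ENNReal.ofReal (min (X 0 ω) (S 0 ω))) (by fun_prop))
        hdegenerate)) (Or.inr hX)
  refine le_of_tendsto' hlim fun n => ?_
  obtain ⟨C, hC, hbound⟩ := h.exists_le_totalAge_add hX0 hX a₀ n
  set K := (∫⁻ ω, min (ENNReal.ofReal (X 0 ω ^ 2)) n ∂P) / 2 +
        (∫⁻ ω, min (ENNReal.ofReal (X 0 ω)) n ∂P) /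
          (1 - (n / (n + 1)) * P {ω | X 0 ω < S 0 ω}) *
        ∫⁻ ω, min (ENNReal.ofReal (min (X 0 ω) (S 0 ω))) n ∂P
  have ht : Tendsto (fun T : ℝ => K / M - C / ENNReal.ofReal T) atTop (nhds (K / M)) := by
    simpa using ENNReal.Tendsto.sub (tendsto_const_nhds (x := K / M)) (tendsto_const_div_ofReal hC)
      (Or.inr ENNReal.zero_ne_top)
  rw [← ht.limsup_eq]
  refine limsup_le_limsup ((eventually_gt_atTop 0).mono fun T hT => ?_)
  have hT0 : ENNReal.ofReal T ≠ 0 := (ENNReal.ofReal_pos.2 hT).ne'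
  rw [tsub_le_iff_right, ← ENNReal.add_div, ENNReal.le_div_iff_mul_le (Or.inl hT0)
    (Or.inl ENNReal.ofReal_ne_top)]
  refine le_trans ?_ (hbound T)
  calc K / M * ENNReal.ofReal T ≤ K / M * (renewalFun P X T * M) := by
        gcongr; exact h.le_renewalFun_mul hX0 hX T
    _ = K / M * M * renewalFun P X T := by ring
    _ = _ := by rw [ENNReal.div_mul_cancel hX hXfin, mul_comm]

/-- Ties have probability zero as soon as one of the two distributions has no atoms. -/
lemma measure_le_eq_measure_lt (h : IsInput P X S)
    (hcont : (∀ x, P {ω | X 0 ω = x} = 0) ∨ (∀ x, P {ω | S 0 ω = x} = 0)) :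
    P {ω | S 0 ω ≤ X 0 ω} = P {ω | S 0 ω < X 0 ω} := by
  have hX0m := h.measurable_left 0
  have hS0m := h.measurable_right 0
  have htie : P {ω | S 0 ω = X 0 ω} = 0 := by
    have hd : MeasurableSet {y : ℝ × ℝ | y.2 = y.1} :=
      measurableSet_eq_fun measurable_snd measurable_fst
    have hmap := (h.indepFun 0 0).map_prod_eq_prod_map_map hX0m.aemeasurable hS0m.aemeasurable
    have hPeq : P {ω | S 0 ω = X 0 ω} = ((P.map (X 0)).prod (P.map (S 0))) {y | y.2 = y.1} := by
      rw [← hmap, Measure.map_apply (hX0m.prodMk hS0m) hd]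
      rfl
    have : IsProbabilityMeasure (P.map (X 0)) := Measure.isProbabilityMeasure_map hX0m.aemeasurable
    have : IsProbabilityMeasure (P.map (S 0)) := Measure.isProbabilityMeasure_map hS0m.aemeasurable
    rw [hPeq]
    rcases hcont with hc | hc
    · rw [Measure.prod_apply_symm hd]
      refine (lintegral_congr fun y => ?_).trans lintegral_zero
      have hset : (fun x => (x, y)) ⁻¹' {y : ℝ × ℝ | y.2 = y.1} = {y} := Set.ext fun x => by
        simp [eq_comm]
      rw [hset, Measure.map_apply hX0m (measurableSet_singleton y)]
      exact hc y
    · rw [Measure.prod_apply hd]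
      refine (lintegral_congr fun y => ?_).trans lintegral_zero
      have hset : Prod.mk y ⁻¹' {y : ℝ × ℝ | y.2 = y.1} = {y} := Set.ext fun x => by simp
      rw [hset, Measure.map_apply hS0m (measurableSet_singleton y)]
      exact hc y
  refine measure_congr ?_
  have hne : ∀ᵐ ω ∂P, S 0 ω ≠ X 0 ω := by rw [ae_iff]; simpa using htie
  filter_upwards [hne] with ω hω
  exact propext ⟨fun hle => lt_of_le_of_ne hle hω, le_of_lt⟩

end IsInput

end

end LCFSp

theorem mainTheorem2 {Ω : Type*} [MeasurableSpace Ω] (P : Measure Ω) [IsProbabilityMeasure P]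
    (X S : ℕ → Ω → ℝ)
    (hXm : ∀ n, Measurable (X n)) (hSm : ∀ n, Measurable (S n))
    (hX0 : ∀ n, ∀ᵐ ω ∂P, 0 ≤ X n ω) (hS0 : ∀ n, ∀ᵐ ω ∂P, 0 ≤ S n ω)
    (hXid : ∀ n, IdentDistrib (X n) (X 0) P P) (hSid : ∀ n, IdentDistrib (S n) (S 0) P P)
    (hindep : iIndepFun (Sum.elim X S) P)
    (hXint : Integrable (X 0) P) (hXpos : 0 < ∫ ω, X 0 ω ∂P)
    (hcont : (∀ x, P {ω | X 0 ω = x} = 0) ∨ (∀ x, P {ω | S 0 ω = x} = 0))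
    (a₀ : ℝ≥0) :
    LCFSp.averageAge P a₀ X S =
      (∫⁻ ω, ENNReal.ofReal (X 0 ω ^ 2) ∂P) / (2 * ∫⁻ ω, ENNReal.ofReal (X 0 ω) ∂P) +
        (∫⁻ ω, ENNReal.ofReal (min (X 0 ω) (S 0 ω)) ∂P) / P {ω | S 0 ω < X 0 ω} := by
  have h : LCFSp.IsInput P X S := ⟨hXm, hSm, hXid, hSid, hindep⟩
  have hX0' := ae_all_iff.2 hX0
  have hM := ofReal_integral_eq_lintegral_ofReal hXint (hX0 0)
  have hX : ∫⁻ ω, ENNReal.ofReal (X 0 ω) ∂P ≠ 0 := hM ▸ (ENNReal.ofReal_pos.2 hXpos).ne'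
  have hXfin : ∫⁻ ω, ENNReal.ofReal (X 0 ω) ∂P ≠ ∞ := hM ▸ ENNReal.ofReal_ne_top
  rw [LCFSp.averageAge_eq_limsup, le_antisymm (h.limsup_totalAge_le hX0' hX hXfin a₀)
    (h.le_limsup_totalAge hX0' hX hXfin a₀), h.measure_le_eq_measure_lt hcont, ENNReal.add_div]
  congr 1
  · simp only [div_eq_mul_inv]
    rw [ENNReal.mul_inv (Or.inl two_ne_zero) (Or.inl (by simp)), mul_assoc]
  · set M := ∫⁻ ω, ENNReal.ofReal (X 0 ω) ∂P
    calc _ = M * M⁻¹ * ((∫⁻ ω, ENNReal.ofReal (min (X 0 ω) (S 0 ω)) ∂P) /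
          P {ω | S 0 ω < X 0 ω}) := by simp only [div_eq_mul_inv]; ring
      _ = _ := by rw [ENNReal.mul_inv_cancel hX hXfin, one_mul]
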